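/- Let $(W,S)$ be a Coxeter system of finite rank $n=|S|$ with Coxeter matrix $(m_{st})_{s,t\in S}$. For a word $\mathbf{s}$ over $S$ let $\omega(\mathbf{s})\in W$ be the element it represents, and let $\omega_n(\mathbf{s})$ be the element it represents in the universal Coxeter group $W_n=\langle S\mid s^2=1\ (s\in S)\rangle$. A reflection is a conjugate of an element of $S$; $l_R$ and $l_{R_n}$ denote the reflection lengths on $W$ and $W_n$, i.e. the least number of reflections whose product is the given element. Let $w\in W$ be represented by an $S$-reduced word $\mathbf{s}=u_1\cdots u_p$ (a word of minimal length representing $w$). Let $D(\mathbf{s})\subseteq\{1,\dots,p\}$ be a deletion set for $\mathbf{s}$, i.e. a set of positions of minimal cardinality such that omitting the letters of $\mathbf{s}$ at these positions leaves a word representing the identity of $W$, and let $\tilde{\mathbf{s}}$ be the word so obtained. A nil-move deletes a consecutive subword $ss$ with $s\in S$ from a word. A braid-move replaces, for distinct $s,t\in S$ with $m_{st}<\infty$, a consecutive alternating subword $sts\cdots$ of length $m_{st}$ by the alternating word $tst\cdots$ of length $m_{st}$. Then $\tilde{\mathbf{s}}$ can be transformed into the empty word by a finite sequence of nil-moves and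 braid-moves, and if $m$ is the minimal number of braid-moves in such a sequence, then $$l_{R_n}(\omega_n(\mathbf{s}))-2m\le l_R(w).$$ -/

import Mathlib

namespace CoxeterMatrix

/-- The Coxeter matrix of the universal Coxeter group with generating set `B`: every off-diagonal
entry is `∞`, which Mathlib encodes as `0` (no relation between distinct generators). -/
noncomputable def universal (B : Type*) : CoxeterMatrix B where
  M := fun i j => open Classical in if i = j then 1 else 0
  isSymm := by
    refine Matrix.IsSymm.ext fun i j => ?_
    by_cases h : i = j
    · simp [h]
    · simp [h, Ne.symm h]
  diagonal := by
    intro i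
    simp
  off_diagonal := by
    intro i j h
    simp [h]

variable {B : Type*}

/-- A nil-move: a consecutive subword `s_i s_i` is replaced by the empty word. -/
inductive NilMove : List B → List B → Prop
  | mk (a b : List B) (i : B) : NilMove (a ++ [i, i] ++ b) (a ++ b)

/-- A braid-move: for distinct letters `i`, `j` with `m_{ij} < ∞`, a consecutive alternating
subword of length `m_{ij}` in `i` and `j` is replaced by the other alternating word of that length.
(`M i j = 0` encodes `m_{ij} = ∞`; both `M i j` and `M j i` are `m_{ij}`.) -/
inductive BraidMove (M : CoxeterMatrix B) : List B → List B → Prop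
  | mk (a b : List B) (i j : B) (hij : i ≠ j) (hfin : M i j ≠ 0) :
      BraidMove M (a ++ CoxeterSystem.braidWord M i j ++ b) (a ++ CoxeterSystem.braidWord M j i ++ b)

/-- `M.TransformsIn k s t`: some finite sequence of nil-moves and braid-moves, exactly `k` of which
are braid-moves, transforms the word `s` into the word `t`. -/
inductive TransformsIn (M : CoxeterMatrix B) : ℕ → List B → List B → Prop
  | refl (s : List B) : TransformsIn M 0 s s
  | nilMove {k : ℕ} {s t u : List B} (h : NilMove s t) (h' : TransformsIn M k t u) :
      TransformsIn M k s u
  | braidMove {k : ℕ} {s t u : List B} (h : M.BraidMove s t) (h' : TransformsIn M k t u) :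
      TransformsIn M (k + 1) s u

end CoxeterMatrix

namespace CoxeterSystem

variable {B W : Type*} [Group W] {M : CoxeterMatrix B} (cs : CoxeterSystem M W)

/-- The reflection length `l_R(w)`: the least length of a factorisation of `w` into reflections.
(Reflections are involutions, so closing the generating set under inverses adds nothing.) -/
noncomputable def reflectionLength (w : W) : ℕ :=
  sInf {k : ℕ | ∃ l : List W, (∀ t ∈ l, cs.IsReflection t) ∧ l.prod = w ∧ l.length = k}

/-- Every element has a factorisation into reflections, so the infimum above is a minimum. -/
theorem exists_reflection_factorisation (w : W) :
    ∃ l : List W, (∀ t ∈ l, cs.IsReflection t) ∧ l.prod = w ∧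
      l.length = cs.reflectionLength w := by
  have hne : {k : ℕ | ∃ l : List W, (∀ t ∈ l, cs.IsReflection t) ∧ l.prod = w ∧
      l.length = k}.Nonempty := by
    obtain ⟨s, rfl⟩ := cs.wordProd_surjective w
    refine ⟨_, s.map cs.simple, ?_, rfl, rfl⟩
    intro t ht
    obtain ⟨i, -, rfl⟩ := List.mem_map.mp ht
    exact cs.isReflection_simple i
  exact Nat.sInf_mem hne

/-- The word obtained from `s` by omitting the letters at the positions in `D`. -/
def omitLetters (s : List B) (D : Finset (Fin s.length)) : List B :=
  ((List.finRange s.length).filter (fun p => p ∉ D)).map s.get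

/-- A deletion set for the word `s`: a set of positions of minimal cardinality among those whose
omission from `s` leaves a word that represents the identity of `W`. -/
def IsDeletionSet (s : List B) (D : Finset (Fin s.length)) : Prop :=
  cs.wordProd (omitLetters s D) = 1 ∧
    ∀ E : Finset (Fin s.length), cs.wordProd (omitLetters s E) = 1 → D.card ≤ E.card

end CoxeterSystem

/-! All estimates are made in the universal group `W_n`. Omitting the letters in `D` changes
`ω_n(s)` by at most `|D|` reflections. A nil-move fixes the element of `W_n`; a braid-move
multiplies it by a conjugate of `x y⁻¹`, where `x`, `y` are the two alternating words, and this is a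
product of two reflections in any Coxeter group (`reflectionLength_alternatingWord_mul_inv_le`).
Reaching the empty word with `m` braid-moves thus gives `l_{R_n}(ω_n(s)) ≤ |D| + 2m`.

Two classical theorems for `W` complete the argument. Dyer's theorem gives `|D| ≤ l_R(w)`: a minimal
reflection factorisation can be chosen descending in length, and each descent deletes one letter by
strong exchange. Tits' solution of the word problem, deduced from Matsumoto's theorem, gives the
sequence of moves. Both rest on the parity cocycle `inversionParity`; Matsumoto's theorem also needs
alternating words of length at most `m_{ij}` to be reduced, which comes from the geometric
representation. -/

namespace CoxeterSystem

variable {B W : Type*} [Group W] {M : CoxeterMatrix B} (cs : CoxeterSystem M W)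

/-! ### Inversion parity and the strong exchange condition. -/

open Classical in
/-- The action of a simple reflection on `W × ZMod 2`: conjugation on the first coordinate, with a
sign change exactly at the simple reflection itself. -/
noncomputable def signedConj (i : B) : Equiv.Perm (W × ZMod 2) :=
  Function.Involutive.toPerm
    (fun x => (cs.simple i * x.1 * cs.simple i, x.2 + if cs.simple i = x.1 then 1 else 0)) <| by
    rintro ⟨g, e⟩
    have h : cs.simple i = cs.simple i * g * cs.simple i ↔ cs.simple i = g := by
      constructor
      · intro h
        have := congrArg (fun y => cs.simple i * y * cs.simple i) h
        simpa [mul_assoc] using this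
      · rintro rfl
        simp
    have h2 : (1 : ZMod 2) + 1 = 0 := by decide
    ext
    · simp [mul_assoc]
    · simp only [h]
      split_ifs <;> simp [add_assoc, h2]

open Classical in
theorem signedConj_apply (i : B) (g : W) (e : ZMod 2) :
    cs.signedConj i (g, e) =
      (cs.simple i * g * cs.simple i, e + if cs.simple i = g then 1 else 0) :=
  rfl

-- Prefixing `i` to `ω` adds `ω⁻¹ s_i ω` to the inversion sequence, and this is the only `g` at
-- which the new letter flips the sign.
open Classical in
theorem prod_map_signedConj (ω : List B) (g : W) (e : ZMod 2) :
    (ω.map cs.signedConj).prod (g, e) =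
      (cs.wordProd ω * g * (cs.wordProd ω)⁻¹, e + (List.count g (cs.rightInvSeq ω) : ℕ)) := by
  induction ω with
  | nil => simp
  | cons i ω ih =>
    have h : cs.simple i = cs.wordProd ω * g * (cs.wordProd ω)⁻¹ ↔
        (cs.wordProd ω)⁻¹ * cs.simple i * cs.wordProd ω = g := by
      constructor
      · intro h
        rw [h]
        group
      · rintro rfl
        group
    rw [List.map_cons, List.prod_cons, Equiv.Perm.mul_apply, ih]
    rw [signedConj_apply]
    refine Prod.ext ?_ ?_
    · simp [wordProd_cons, mul_assoc]
    · simp only [h, rightInvSeq, List.count_cons, beq_iff_eq]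
      split_ifs <;> simp [add_assoc]

-- The inversion sequence has period `M i j`, so its two halves coincide and every element is
-- counted twice.
open Classical in
theorem even_count_leftInvSeq_alternatingWord (i j : B) (g : W) :
    Even (List.count g (cs.leftInvSeq (alternatingWord i j (2 * M i j)))) := by
  set m := M i j with hm
  set L := cs.leftInvSeq (alternatingWord i j (2 * m)) with hL
  have hlen : L.length = 2 * m := by simp [hL]
  have hdrop : L.drop m = L.take m := by
    apply List.ext_getElem
    · simp [hlen]
      omega
    · intro k h₁ h₂
      have hk : k < m := by
        simp [hlen] at h₂
        omega
      rw [List.getElem_drop, List.getElem_take]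
      simp only [hL]
      rw [cs.getElem_leftInvSeq_alternatingWord i j m _ (by omega),
        cs.getElem_leftInvSeq_alternatingWord i j m _ (by omega),
        prod_alternatingWord_eq_mul_pow, prod_alternatingWord_eq_mul_pow]
      have e₁ : (2 * (m + k) + 1) / 2 = m + k := by omega
      have e₂ : (2 * k + 1) / 2 = k := by omega
      have o₁ : ¬ Even (2 * (m + k) + 1) := by simp
      have o₂ : ¬ Even (2 * k + 1) := by simp
      rw [if_neg o₁, if_neg o₂, e₁, e₂, pow_add, hm, simple_mul_simple_pow', one_mul]
  rw [← List.take_append_drop m L, List.count_append, hdrop]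
  exact ⟨_, rfl⟩

theorem isLiftable_signedConj : M.IsLiftable cs.signedConj := by
  classical
  intro i j
  have hmap : ∀ n : ℕ, (cs.signedConj i * cs.signedConj j) ^ n =
      ((alternatingWord i j (2 * n)).map cs.signedConj).prod := by
    intro n
    induction n with
    | zero => simp [alternatingWord]
    | succ n ih =>
      rw [pow_succ, ih, show 2 * (n + 1) = 2 * n + 1 + 1 by ring, alternatingWord_succ,
        alternatingWord_succ]
      simp
  -- Reversal turns the right inversion sequence into the left one, to which the parity count
  -- applies.
  have hrev : alternatingWord i j (2 * M i j) = (alternatingWord j i (2 * M i j)).reverse := by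
    apply List.ext_getElem
    · simp
    · intro k h₁ h₂
      have hk : k < 2 * M i j := by simpa using h₁
      rw [List.getElem_reverse, getElem_alternatingWord _ _ _ _ hk,
        getElem_alternatingWord _ _ _ _ (by simp; omega)]
      simp only [length_alternatingWord]
      by_cases h : Even k
      · have : ¬ Even (2 * M i j + (2 * M i j - 1 - k)) := by
          rw [Nat.even_iff] at *
          omega
        rw [if_neg this, if_pos (by simpa [parity_simps] using h)]
      · have : Even (2 * M i j + (2 * M i j - 1 - k)) := by
          rw [Nat.even_iff] at *
          omega
        rw [if_pos this, if_neg (by simpa [parity_simps] using h)]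
  ext1 ⟨g, e⟩
  have hcount : Even (List.count g (cs.rightInvSeq (alternatingWord i j (2 * M i j)))) := by
    rw [hrev, rightInvSeq_reverse, List.count_reverse, M.symmetric i j]
    exact cs.even_count_leftInvSeq_alternatingWord j i g
  have hprod : cs.wordProd (alternatingWord i j (2 * M i j)) = 1 := by
    simp [prod_alternatingWord_eq_mul_pow]
  rw [hmap, prod_map_signedConj, hprod, (ZMod.natCast_eq_zero_iff_even).mpr hcount]
  simp

/-- The parity of the number of occurrences of `t` in the right inversion sequence of any word
for `w`. -/
noncomputable def inversionParity (w t : W) : ZMod 2 :=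
  (cs.lift ⟨cs.signedConj, cs.isLiftable_signedConj⟩ w (t, 0)).2

open Classical in
theorem lift_signedConj_wordProd (ω : List B) (g : W) (e : ZMod 2) :
    cs.lift ⟨cs.signedConj, cs.isLiftable_signedConj⟩ (cs.wordProd ω) (g, e) =
      (cs.wordProd ω * g * (cs.wordProd ω)⁻¹, e + (List.count g (cs.rightInvSeq ω) : ℕ)) := by
  rw [← prod_map_signedConj, wordProd, map_list_prod, List.map_map]
  congr 3
  ext1 i
  simp

open Classical in
theorem inversionParity_wordProd (ω : List B) (t : W) :
    cs.inversionParity (cs.wordProd ω) t = (List.count t (cs.rightInvSeq ω) : ℕ) := by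
  simp [inversionParity, lift_signedConj_wordProd]

theorem inversionParity_mul (u v t : W) :
    cs.inversionParity (u * v) t =
      cs.inversionParity u (v * t * v⁻¹) + cs.inversionParity v t := by
  classical
  obtain ⟨ω, rfl⟩ := cs.wordProd_surjective u
  obtain ⟨ω', rfl⟩ := cs.wordProd_surjective v
  simp [inversionParity, lift_signedConj_wordProd, add_comm]

@[simp]
theorem inversionParity_one (t : W) : cs.inversionParity 1 t = 0 := by
  rw [← cs.wordProd_nil, inversionParity_wordProd]
  simp

theorem inversionParity_simple_self (i : B) :
    cs.inversionParity (cs.simple i) (cs.simple i) = 1 := by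
  rw [← cs.wordProd_singleton, inversionParity_wordProd]
  simp

theorem inversionParity_simple_of_ne {i : B} {t : W} (h : cs.simple i ≠ t) :
    cs.inversionParity (cs.simple i) t = 0 := by
  rw [← cs.wordProd_singleton, inversionParity_wordProd]
  simp [h]

/-- For `t = u s u⁻¹` the cocycle contributions of `u` and `u⁻¹` cancel because `u u⁻¹ = 1`, leaving
that of `s` at itself. -/
theorem IsReflection.inversionParity_self {t : W} (ht : cs.IsReflection t) :
    cs.inversionParity t t = 1 := by
  obtain ⟨u, i, rfl⟩ := ht
  have h₁ := cs.inversionParity_mul (u * cs.simple i) u⁻¹ (u * cs.simple i * u⁻¹)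
  have h₂ := cs.inversionParity_mul u (cs.simple i) (cs.simple i)
  have h₃ := cs.inversionParity_mul u u⁻¹ (u * cs.simple i * u⁻¹)
  have e₁ : u⁻¹ * (u * cs.simple i * u⁻¹) * u⁻¹⁻¹ = cs.simple i := by group
  rw [e₁] at h₁ h₃
  simp only [mul_inv_cancel, inversionParity_one] at h₃
  simp only [mul_inv_cancel_right, inversionParity_simple_self] at h₂
  rw [h₁, h₂, add_right_comm, ← h₃, zero_add]

theorem mem_rightInvSeq_of_inversionParity {ω : List B} {t : W}
    (h : cs.inversionParity (cs.wordProd ω) t ≠ 0) : t ∈ cs.rightInvSeq ω := by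
  classical
  rw [inversionParity_wordProd] at h
  by_contra hn
  exact h (by simp [List.count_eq_zero_of_not_mem hn])

theorem inversionParity_of_mem_of_nodup {ω : List B} {t : W} (hω : (cs.rightInvSeq ω).Nodup)
    (ht : t ∈ cs.rightInvSeq ω) : cs.inversionParity (cs.wordProd ω) t = 1 := by
  classical
  rw [inversionParity_wordProd, List.count_eq_one_of_mem hω ht, Nat.cast_one]

theorem isRightInversion_of_inversionParity {w t : W} (h : cs.inversionParity w t ≠ 0) :
    cs.IsRightInversion w t := by
  obtain ⟨ω, hω, rfl⟩ := cs.exists_isReduced w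
  exact cs.isRightInversion_of_mem_rightInvSeq hω (cs.mem_rightInvSeq_of_inversionParity h)

/-- Multiplying by `t` flips the parity at `t`. If it were zero at `w`, it would be one at `w t`, so
`t` would shorten `w t` back to `w`, against `t` shortening `w`. -/
theorem inversionParity_eq_one_iff {w t : W} :
    cs.inversionParity w t = 1 ↔ cs.IsRightInversion w t := by
  refine ⟨fun h => cs.isRightInversion_of_inversionParity (by simp [h]), fun h => ?_⟩
  by_contra hn
  have h₀ : cs.inversionParity w t = 0 := by
    generalize cs.inversionParity w t = a at hn
    revert a
    decide
  have h₁ : cs.inversionParity (w * t) t = 1 := by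
    rw [inversionParity_mul, mul_inv_cancel_right, h₀, zero_add, h.1.inversionParity_self]
  have h₂ := (cs.isRightInversion_of_inversionParity (w := w * t) (t := t) (by simp [h₁])).2
  rw [mul_assoc, h.1.mul_self, mul_one] at h₂
  exact absurd h.2 (by omega)

theorem inversionParity_eq_zero_iff {w t : W} :
    cs.inversionParity w t = 0 ↔ ¬ cs.IsRightInversion w t := by
  rw [← inversionParity_eq_one_iff]
  generalize cs.inversionParity w t = a
  revert a
  decide

/-- The strong exchange condition. -/
theorem IsRightInversion.mem_rightInvSeq {ω : List B} {t : W}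
    (h : cs.IsRightInversion (cs.wordProd ω) t) : t ∈ cs.rightInvSeq ω :=
  cs.mem_rightInvSeq_of_inversionParity (by simp [cs.inversionParity_eq_one_iff.mpr h])

theorem IsRightInversion.exists_eraseIdx {ω : List B} {t : W}
    (h : cs.IsRightInversion (cs.wordProd ω) t) :
    ∃ p < ω.length, cs.wordProd ω * t = cs.wordProd (ω.eraseIdx p) := by
  obtain ⟨p, hp, rfl⟩ := List.mem_iff_getElem.mp h.mem_rightInvSeq
  refine ⟨p, by simpa using hp, ?_⟩
  rw [← wordProd_mul_getD_rightInvSeq, List.getD_eq_getElem _ _ hp]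

/-- Entries occurring once have odd parity, so all of them appear in the inversion sequence of any
reduced word for the same element. -/
theorem isReduced_of_nodup_rightInvSeq {ω : List B} (hω : (cs.rightInvSeq ω).Nodup) :
    cs.IsReduced ω := by
  obtain ⟨ω', hω', h⟩ := cs.exists_isReduced (cs.wordProd ω)
  have hsub : cs.rightInvSeq ω ⊆ cs.rightInvSeq ω' := fun t ht =>
    cs.mem_rightInvSeq_of_inversionParity
      (by rw [← h, cs.inversionParity_of_mem_of_nodup hω ht]; exact one_ne_zero)
  have hle := (hω.subperm hsub).length_le
  rw [length_rightInvSeq, length_rightInvSeq, ← hω'.eq, ← h] at hle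
  exact le_antisymm (cs.length_wordProd_le ω) hle

end CoxeterSystem

/-! ### The geometric representation and reducedness of alternating words. -/

open Polynomial.Chebyshev in
-- The product acts as a rotation by `θ = 2π/m`. Its powers have coefficients in the Chebyshev
-- values `S_n(2 cos θ) = sin((n+1)θ)/sin θ`, which cancel at `mθ = 2π`. The case `m = 2` is
-- separate since then `sin θ = 0`.
theorem Module.reflection_mul_reflection_pow_eq_one {V : Type*} [AddCommGroup V] [Module ℝ V]
    {x y : V} {f g : Module.Dual ℝ V} (hf : f x = 2) (hg : g y = 2) {m : ℕ} (hm : 2 ≤ m)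
    (hfy : f y = -2 * Real.cos (Real.pi / m)) (hgx : g x = -2 * Real.cos (Real.pi / m)) :
    (Module.reflection hf * Module.reflection hg) ^ m = 1 := by
  rcases hm.eq_or_lt with rfl | hm3
  · ext z
    have hfy' : f y = 0 := by simp [hfy]
    have hgx' : g x = 0 := by simp [hgx]
    simp only [pow_two, LinearEquiv.mul_apply, Module.reflection_apply, map_sub, map_smul, hf, hg,
      hfy', hgx', LinearEquiv.coe_one, id_eq]
    match_scalars <;> simp <;> ring
  · set θ : ℝ := 2 * Real.pi / m with hθ
    have hm0 : (0 : ℝ) < m := by positivity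
    have hsin : Real.sin θ ≠ 0 := by
      apply ne_of_gt
      apply Real.sin_pos_of_pos_of_lt_pi
      · positivity
      · rw [hθ, div_lt_iff₀ hm0]
        have : (3 : ℝ) ≤ m := by exact_mod_cast hm3
        nlinarith [Real.pi_pos]
    have ht : 2 * Real.cos θ = f y * g x - 2 := by
      rw [hfy, hgx, hθ, show 2 * Real.pi / m = 2 * (Real.pi / m) by ring, Real.cos_two_mul]
      ring
    have hS : ∀ n : ℤ, (S ℝ n).eval (2 * Real.cos θ) = Real.sin ((n + 1) * θ) / Real.sin θ :=
      fun n => by rw [← S_two_mul_real_cos, mul_div_cancel_right₀ _ hsin]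
    ext z
    rw [Module.reflection_mul_reflection_pow_apply hf hg m z (2 * Real.cos θ) ht]
    have hmθ : (m : ℝ) * θ = 2 * Real.pi := by
      rw [hθ]
      field_simp
    -- The power formula has half-integer-part indices: its vanishing factor is `S_{p-1}` for `m =
    -- 2p` and `S_p + S_{p-1}` for `m = 2p + 1`.
    rcases Nat.even_or_odd' m with ⟨p, hp | hp⟩
    · have h₁ : ((m : ℤ) - 2) / 2 = p - 1 := by omega
      have h₂ : ((m : ℤ) - 1) / 2 = p - 1 := by omega
      have h₀ : (S ℝ ((p : ℤ) - 1)).eval (2 * Real.cos θ) = 0 := by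
        have : (p : ℝ) * θ = Real.pi := by
          rw [hp] at hmθ
          push_cast at hmθ
          linarith
        rw [hS]
        push_cast
        rw [sub_add_cancel, this, Real.sin_pi, zero_div]
      rw [h₁, h₂, h₀]
      simp
    · have h₁ : ((m : ℤ) - 2) / 2 = p - 1 := by omega
      have h₂ : ((m : ℤ) - 1) / 2 = p := by omega
      have h₃ : ((m : ℤ) - 3) / 2 = p - 1 := by omega
      have h₄ : (m : ℤ) / 2 = p := by omega
      have h₀ : (S ℝ (p : ℤ)).eval (2 * Real.cos θ) +
          (S ℝ ((p : ℤ) - 1)).eval (2 * Real.cos θ) = 0 := by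
        have : ((p : ℝ) + 1) * θ = 2 * Real.pi - p * θ := by
          rw [hp] at hmθ
          push_cast at hmθ
          linarith
        rw [hS, hS]
        push_cast
        rw [sub_add_cancel, this, Real.sin_two_pi_sub, ← add_div, neg_add_cancel, zero_div]
      rw [h₁, h₂, h₃, h₄, h₀]
      simp

-- Expand the image of `x` in `x` and `y`. For `m ≥ 3`, independence forces `S_{q-1} = 0` and `S_q =
-- 1`, hence `cos(qθ) = 1`, impossible for `0 < qθ < 2π`.
open Polynomial.Chebyshev in
theorem Module.reflection_mul_reflection_pow_ne_one {V : Type*} [AddCommGroup V] [Module ℝ V]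
    {x y : V} {f g : Module.Dual ℝ V} (hf : f x = 2) (hg : g y = 2) {m : ℕ} (hm : m ≠ 1)
    (hfy : f y = -2 * Real.cos (Real.pi / m)) (hgx : g x = -2 * Real.cos (Real.pi / m))
    (hxy : LinearIndependent ℝ ![x, y]) {q : ℕ} (hq : 0 < q) (hqm : q < m ∨ m = 0) :
    (Module.reflection hf * Module.reflection hg) ^ q ≠ 1 := by
  intro h
  have hx := Module.reflection_mul_reflection_pow_apply_self hf hg q
  rw [h, LinearEquiv.coe_one, id_eq] at hx
  obtain ⟨ha, hb⟩ := LinearIndependent.pair_iff.mp hxy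
    ((S ℝ q).eval (f y * g x - 2) + (S ℝ (q - 1)).eval (f y * g x - 2) - 1)
    ((S ℝ (q - 1)).eval (f y * g x - 2) * -g x)
    (by rw [sub_smul, one_smul, sub_add_eq_add_sub, ← hx, sub_self])
  have ht : f y * g x - 2 = 2 * Real.cos (2 * Real.pi / m) := by
    rw [hfy, hgx, show 2 * Real.pi / m = 2 * (Real.pi / m) by ring, Real.cos_two_mul]
    ring
  rw [ht] at ha hb
  -- For `m = 0`, encoding `∞`, division by zero gives `cos 0 = 1`; the argument of `S` is `2`, and
  -- `S_{q-1}(2) = q` is nonzero.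
  obtain rfl | hm0 := Nat.eq_zero_or_pos m
  · simp [hgx, S_eval_two] at hb
    omega
  have hqm : q < m := by omega
  obtain rfl | hm3 : m = 2 ∨ 3 ≤ m := by omega
  · obtain rfl : q = 1 := by omega
    norm_num [S_zero, S_one] at ha
  · set θ : ℝ := 2 * Real.pi / m with hθ
    have hm0 : (0 : ℝ) < m := by positivity
    have hm3' : (3 : ℝ) ≤ m := by exact_mod_cast hm3
    have hsin : Real.sin θ ≠ 0 := by
      apply ne_of_gt
      apply Real.sin_pos_of_pos_of_lt_pi
      · positivity
      · rw [hθ, div_lt_iff₀ hm0]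
        nlinarith [Real.pi_pos]
    have hcos : g x ≠ 0 := by
      rw [hgx]
      refine mul_ne_zero (by norm_num) (ne_of_gt (Real.cos_pos_of_mem_Ioo ⟨?_, ?_⟩))
      · have : 0 < Real.pi / m := by positivity
        linarith [Real.pi_pos]
      · rw [div_lt_div_iff₀ hm0 two_pos]
        nlinarith [Real.pi_pos]
    have hS : (S ℝ ((q : ℤ) - 1)).eval (2 * Real.cos θ) = 0 := by
      rcases mul_eq_zero.mp hb with h | h
      · exact h
      · exact absurd (neg_eq_zero.mp h) hcos
    have hq0 := S_two_mul_real_cos θ ((q : ℤ) - 1)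
    rw [hS, zero_mul] at hq0
    push_cast at hq0
    rw [sub_add_cancel] at hq0
    rw [hS, add_zero, sub_eq_zero] at ha
    have hq1 := S_two_mul_real_cos θ (q : ℤ)
    rw [ha, one_mul] at hq1
    push_cast at hq1
    rw [add_mul, one_mul, Real.sin_add, ← hq0, zero_mul, zero_add] at hq1
    have hc : Real.cos (q * θ) = 1 := by
      have : (Real.cos (q * θ) - 1) * Real.sin θ = 0 := by linarith
      rcases mul_eq_zero.mp this with h | h
      · linarith
      · exact absurd h hsin
    have hpos : 0 < (q : ℝ) * θ := by positivity
    have hlt : (q : ℝ) * θ < 2 * Real.pi := by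
      rw [hθ, ← mul_div_assoc, div_lt_iff₀ hm0]
      have : (q : ℝ) < m := by exact_mod_cast hqm
      nlinarith [Real.pi_pos]
    have := (Real.cos_eq_one_iff_of_lt_of_lt (by linarith [Real.pi_pos]) hlt).mp hc
    exact hpos.ne' this

namespace CoxeterMatrix

variable {B : Type*} (M : CoxeterMatrix B)

/-- The functional `2 ⟨e_i, ·⟩` for the standard bilinear form of a Coxeter matrix. -/
noncomputable def coroot (i : B) : Module.Dual ℝ (B →₀ ℝ) :=
  Finsupp.linearCombination ℝ fun j => -2 * Real.cos (Real.pi / M i j)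

theorem coroot_single (i j : B) :
    M.coroot i (Finsupp.single j 1) = -2 * Real.cos (Real.pi / M i j) := by
  simp [coroot]

theorem coroot_single_self (i : B) : M.coroot i (Finsupp.single i 1) = 2 := by
  simp [coroot_single]

theorem isLiftable_reflection :
    M.IsLiftable fun i => Module.reflection (M.coroot_single_self i) := by
  intro i j
  by_cases hij : i = j
  · subst hij
    rw [M.diagonal, pow_one]
    exact inv_mul_cancel (Module.reflection (M.coroot_single_self i))
  · rcases Nat.eq_zero_or_pos (M i j) with h | h
    · rw [h, pow_zero]
    · have := M.off_diagonal i j hij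
      exact Module.reflection_mul_reflection_pow_eq_one _ _ (by omega) (M.coroot_single i j)
        (by rw [coroot_single, M.symmetric])

end CoxeterMatrix

namespace CoxeterSystem

variable {B W : Type*} [Group W] {M : CoxeterMatrix B} (cs : CoxeterSystem M W)

theorem simple_mul_simple_pow_ne_one {i j : B} (hij : i ≠ j) {q : ℕ} (hq : 0 < q)
    (hqm : q < M i j ∨ M i j = 0) : (cs.simple i * cs.simple j) ^ q ≠ 1 := by
  intro h
  have h' := congrArg (cs.lift ⟨_, M.isLiftable_reflection⟩) h
  rw [map_pow, map_mul, lift_apply_simple, lift_apply_simple, map_one] at h'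
  refine Module.reflection_mul_reflection_pow_ne_one _ _ (M.off_diagonal i j hij)
    (M.coroot_single i j) (by rw [M.coroot_single, M.symmetric]) ?_ hq hqm h'
  rw [LinearIndependent.pair_iff]
  intro a b hab
  have h₁ := DFunLike.congr_fun hab i
  have h₂ := DFunLike.congr_fun hab j
  simpa [hij, hij.symm] using And.intro h₁ h₂

theorem rightInvSeq_alternatingWord (i j : B) (m : ℕ) :
    cs.rightInvSeq (alternatingWord i j m) =
      (List.range m).reverse.map fun k => cs.simple j * (cs.simple i * cs.simple j) ^ k := by
  have hconj : ∀ k : ℕ, ((cs.simple i * cs.simple j) ^ k)⁻¹ * cs.simple j =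
      cs.simple j * (cs.simple i * cs.simple j) ^ k := by
    intro k
    have h : (cs.simple i * cs.simple j)⁻¹ * cs.simple j =
        cs.simple j * (cs.simple i * cs.simple j) := by simp [mul_assoc]
    have := SemiconjBy.pow_right (a := cs.simple j) (x := cs.simple i * cs.simple j)
      (y := (cs.simple i * cs.simple j)⁻¹) h.symm k
    rw [inv_pow] at this
    exact this.symm
  induction m with
  | zero => simp [alternatingWord]
  | succ m ih =>
    rw [alternatingWord_succ', rightInvSeq, ih, List.range_succ, List.reverse_append,
      List.map_append, List.reverse_singleton, List.map_singleton, List.singleton_append,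
      prod_alternatingWord_eq_mul_pow]
    congr 1
    rcases Nat.even_or_odd' m with ⟨p, rfl | rfl⟩
    · rw [if_pos (even_two_mul p), if_pos (even_two_mul p), Nat.mul_div_cancel_left p two_pos,
        one_mul, hconj, mul_assoc, ← pow_add, two_mul]
    · have h : ¬ Even (2 * p + 1) := by simp
      rw [if_neg h, if_neg h, show (2 * p + 1) / 2 = p by omega, mul_inv_rev,
        inv_simple, hconj, show 2 * p + 1 = p + (1 + p) by ring, pow_add, pow_add, pow_one]
      simp only [mul_assoc]

/-- The inversions are `s_j (s_i s_j)^k` for `k < m`, distinct because no smaller positive power of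
`s_i s_j` is trivial. -/
theorem isReduced_alternatingWord {i j : B} (hij : i ≠ j) {m : ℕ} (hm : m ≤ M i j ∨ M i j = 0) :
    cs.IsReduced (alternatingWord i j m) := by
  apply isReduced_of_nodup_rightInvSeq
  rw [rightInvSeq_alternatingWord]
  have key : ∀ a b : ℕ, a < b → b < m →
      (cs.simple i * cs.simple j) ^ a ≠ (cs.simple i * cs.simple j) ^ b := by
    intro a b hab hb h
    obtain ⟨d, rfl⟩ := Nat.exists_eq_add_of_lt hab
    rw [add_assoc, pow_add, eq_comm, mul_eq_left] at h
    exact cs.simple_mul_simple_pow_ne_one hij (by omega) (by omega) h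
  refine List.Nodup.map_on ?_ (List.nodup_reverse.mpr List.nodup_range)
  intro a ha b hb hab
  simp only [List.mem_reverse, List.mem_range] at ha hb
  have hab' := mul_left_cancel hab
  rcases lt_trichotomy a b with h | h | h
  · exact absurd hab' (key a b h hb)
  · exact h
  · exact absurd hab'.symm (key b a h ha)

end CoxeterSystem

/-! ### Matsumoto's theorem and the word problem. -/

namespace CoxeterMatrix

variable {B : Type*} {M : CoxeterMatrix B}

theorem NilMove.append {s t : List B} (h : NilMove s t) (c : List B) :
    NilMove (s ++ c) (t ++ c) := by
  obtain ⟨a, b, i⟩ := h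
  simpa using NilMove.mk a (b ++ c) i

theorem BraidMove.append {s t : List B} (h : M.BraidMove s t) (c : List B) :
    M.BraidMove (s ++ c) (t ++ c) := by
  obtain ⟨a, b, i, j, hij, hfin⟩ := h
  simpa using BraidMove.mk (M := M) a (b ++ c) i j hij hfin

theorem TransformsIn.trans {k l : ℕ} {s t u : List B} (h : M.TransformsIn k s t)
    (h' : M.TransformsIn l t u) : M.TransformsIn (k + l) s u := by
  induction h with
  | refl => rwa [zero_add]
  | nilMove hm _ ih => exact .nilMove hm (ih h')
  | braidMove hm _ ih =>
    rw [add_right_comm]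
    exact .braidMove hm (ih h')

theorem TransformsIn.append {k : ℕ} {s t : List B} (h : M.TransformsIn k s t) (c : List B) :
    M.TransformsIn k (s ++ c) (t ++ c) := by
  induction h with
  | refl => exact .refl _
  | nilMove hm _ ih => exact .nilMove (hm.append c) ih
  | braidMove hm _ ih => exact .braidMove (hm.append c) ih

end CoxeterMatrix

namespace CoxeterSystem

open CoxeterMatrix

variable {B W : Type*} [Group W] {M : CoxeterMatrix B} (cs : CoxeterSystem M W)

theorem IsReduced.isRightDescent {cs : CoxeterSystem M W} {a : List B} {i : B}
    (h : cs.IsReduced (a ++ [i])) : cs.IsRightDescent (cs.wordProd (a ++ [i])) i := by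
  have h₁ := cs.length_wordProd_le a
  rw [IsRightDescent, h.eq, wordProd_append, wordProd_singleton, simple_mul_simple_cancel_right]
  simp
  omega

theorem isReduced_prefix {cs : CoxeterSystem M W} {a b : List B}
    (h : cs.IsReduced (a ++ b)) : cs.IsReduced a := by
  simpa using h.take a.length

theorem isReduced_suffix {cs : CoxeterSystem M W} {a b : List B}
    (h : cs.IsReduced (a ++ b)) : cs.IsReduced b := by
  simpa using h.drop a.length

/-- An element with distinct right descents `i` and `j` has a reduced word ending in any given
alternating word in `i` and `j` of length at most `M i j`. -/
theorem exists_isReduced_append_alternatingWord {w : W} (k : ℕ) {i j : B} (hij : i ≠ j)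
    (hi : cs.IsRightDescent w i) (hj : cs.IsRightDescent w j) (hk : k ≤ M i j ∨ M i j = 0) :
    ∃ v : List B, cs.IsReduced (v ++ alternatingWord i j k) ∧
      cs.wordProd (v ++ alternatingWord i j k) = w := by
  induction k generalizing i j with
  | zero =>
    obtain ⟨ω, hω, rfl⟩ := cs.exists_isReduced w
    exact ⟨ω, by simpa [alternatingWord] using hω, by simp [alternatingWord]⟩
  | succ k ih =>
    obtain ⟨v, hv, hw⟩ := ih hij.symm hj hi (by rw [M.symmetric]; omega)
    have hj' : cs.IsRightInversion (cs.wordProd (v ++ alternatingWord j i k)) (cs.simple j) := by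
      rwa [hw, isRightInversion_simple_iff_isRightDescent]
    -- The tail followed by `j` is still reduced, so `s_j` does not shorten the tail; exchange must
    -- therefore delete a letter of `v`.
    have hsplit : cs.simple j ∉ cs.rightInvSeq (alternatingWord j i k) := by
      intro hmem
      have h₁ := (cs.isRightInversion_of_mem_rightInvSeq (isReduced_suffix hv) hmem).2
      have h₂ := (cs.isReduced_alternatingWord hij hk).eq
      rw [alternatingWord_succ, wordProd_concat] at h₂
      have h₃ := cs.length_wordProd_le (alternatingWord j i k)
      simp at h₂ h₃
      omega
    obtain ⟨p, hp, hpj⟩ := List.mem_iff_getElem.mp hj'.mem_rightInvSeq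
    have hpv : p < v.length := by
      by_contra hn
      apply hsplit
      have hd := cs.rightInvSeq_drop (v ++ alternatingWord j i k) v.length
      rw [List.drop_left] at hd
      rw [hd, ← hpj, List.mem_drop_iff_getElem]
      refine ⟨p - v.length, by omega, ?_⟩
      congr 1
      omega
    have herase := cs.wordProd_mul_getD_rightInvSeq (v ++ alternatingWord j i k) p
    rw [List.getD_eq_getElem _ _ hp, hpj, List.eraseIdx_append_of_lt_length hpv] at herase
    have hprod : cs.wordProd (v.eraseIdx p ++ alternatingWord i j (k + 1)) = w := by
      rw [alternatingWord_succ, List.concat_eq_append, ← List.append_assoc, wordProd_append,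
        ← herase, wordProd_singleton, simple_mul_simple_cancel_right, hw]
    refine ⟨v.eraseIdx p, ?_, hprod⟩
    rw [IsReduced, hprod, ← hw, hv.eq]
    have := List.length_eraseIdx_add_one hpv
    simp
    omega

/-- Otherwise `w` would have a reduced word with an alternating tail longer than `w` itself. -/
theorem coxeterMatrix_ne_zero_of_isRightDescent {w : W} {i j : B} (hij : i ≠ j)
    (hi : cs.IsRightDescent w i) (hj : cs.IsRightDescent w j) : M i j ≠ 0 := by
  intro h
  obtain ⟨v, hv, hw⟩ := cs.exists_isReduced_append_alternatingWord (cs.length w + 1) hij hi hj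
    (.inr h)
  have := hv.eq
  rw [hw] at this
  simp at this
  omega

/-- Matsumoto's theorem: reduced words for the same element are related by braid-moves. -/
theorem exists_transformsIn_of_isReduced {a b : List B} (ha : cs.IsReduced a)
    (hb : cs.IsReduced b) (hab : cs.wordProd a = cs.wordProd b) :
    ∃ k, M.TransformsIn k a b := by
  have hlen : b.length = a.length := by rw [← ha.eq, ← hb.eq, hab]
  generalize hn : a.length = n at hlen
  induction n generalizing a b with
  | zero =>
    obtain rfl := List.length_eq_zero_iff.mp hn
    obtain rfl := List.length_eq_zero_iff.mp hlen
    exact ⟨0, .refl _⟩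
  | succ n ih =>
    have hstep : ∀ {a b : List B} {i : B}, cs.IsReduced (a ++ [i]) → cs.IsReduced (b ++ [i]) →
        cs.wordProd (a ++ [i]) = cs.wordProd (b ++ [i]) → (a ++ [i]).length = n + 1 →
        (b ++ [i]).length = n + 1 → ∃ k, M.TransformsIn k (a ++ [i]) (b ++ [i]) := by
      intro a b i ha hb hab hla hlb
      rw [wordProd_append, wordProd_append, mul_left_inj] at hab
      obtain ⟨k, hk⟩ := ih (isReduced_prefix ha) (isReduced_prefix hb) hab (by simpa using hla)
        (by simpa using hlb)
      exact ⟨k, hk.append _⟩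
    obtain ⟨a, i, rfl⟩ := a.eq_nil_or_concat'.resolve_left (by rintro rfl; simp at hn)
    obtain ⟨b, j, rfl⟩ := b.eq_nil_or_concat'.resolve_left (by rintro rfl; simp at hlen)
    by_cases hij : i = j
    · subst hij
      exact hstep ha hb hab hn hlen
    have hi := ha.isRightDescent
    have hj := hb.isRightDescent
    rw [← hab] at hj
    have h0 := cs.coxeterMatrix_ne_zero_of_isRightDescent hij hi hj
    -- Two bridging words differ by one braid-move: one ends in `i` like the first word, the other
    -- in `j` like the second, so `hstep` applies on either side.
    obtain ⟨v, hv, hvw⟩ := cs.exists_isReduced_append_alternatingWord (M j i) (Ne.symm hij) hj hi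
      (.inl le_rfl)
    have hmove : M.BraidMove (v ++ braidWord M j i) (v ++ braidWord M i j) := by
      have := BraidMove.mk (M := M) v [] j i (Ne.symm hij) (by rwa [M.symmetric])
      simpa using this
    have hvw' : cs.wordProd (v ++ braidWord M i j) = cs.wordProd (a ++ [i]) := by
      rw [← hvw, wordProd_append, wordProd_append, wordProd_braidWord_eq]
    have hv' : cs.IsReduced (v ++ braidWord M i j) := by
      rw [IsReduced, hvw', ← hvw, hv.eq, List.length_append, List.length_append,
        length_alternatingWord, length_alternatingWord, M.symmetric]
    have hend : ∀ i j : B, M i j ≠ 0 → ∃ c, braidWord M i j = c ++ [j] := by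
      intro i j h
      obtain ⟨d, hd⟩ := Nat.exists_eq_succ_of_ne_zero h
      exact ⟨alternatingWord j i d, by rw [braidWord, hd, alternatingWord_succ,
        List.concat_eq_append]⟩
    obtain ⟨c, hc⟩ := hend j i (by rwa [M.symmetric])
    obtain ⟨c', hc'⟩ := hend i j h0
    change cs.IsReduced (v ++ braidWord M j i) at hv
    change cs.wordProd (v ++ braidWord M j i) = _ at hvw
    rw [hc, ← List.append_assoc] at hv hvw hmove
    rw [hc', ← List.append_assoc] at hv' hvw' hmove
    obtain ⟨k, hk⟩ := hstep ha hv hvw.symm hn (by rw [← hv.eq, hvw, ha.eq, hn])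
    obtain ⟨l, hl⟩ := hstep hv' hb (hvw'.trans hab) (by rw [← hv'.eq, hvw', ha.eq, hn]) hlen
    exact ⟨_, hk.trans (.braidMove hmove hl)⟩

/-- If appending `i` to a reduced word breaks reducedness, Matsumoto's theorem brings that word to
one ending in `i`, and a nil-move removes `i i`. -/
theorem exists_isReduced_transformsIn (s : List B) :
    ∃ t k, cs.IsReduced t ∧ cs.wordProd t = cs.wordProd s ∧ M.TransformsIn k s t := by
  induction s using List.reverseRecOn with
  | nil => exact ⟨[], 0, by simp [IsReduced], rfl, .refl _⟩
  | append_singleton s i ih =>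
    obtain ⟨t, k, ht, hts, hk⟩ := ih
    have hprod : cs.wordProd (t ++ [i]) = cs.wordProd (s ++ [i]) := by
      rw [wordProd_append, wordProd_append, hts]
    by_cases hti : cs.IsReduced (t ++ [i])
    · exact ⟨t ++ [i], k, hti, hprod, hk.append _⟩
    have hlen : cs.length (cs.wordProd t * cs.simple i) + 1 = cs.length (cs.wordProd t) := by
      refine (cs.length_mul_simple _ i).resolve_left fun h => hti ?_
      rw [IsReduced, wordProd_append, wordProd_singleton, h, ht.eq, List.length_append,
        List.length_singleton]
    obtain ⟨a, ha, hat⟩ := cs.exists_isReduced (cs.wordProd t * cs.simple i)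
    have hat' : cs.wordProd (a ++ [i]) = cs.wordProd t := by
      rw [wordProd_append, wordProd_singleton, ← hat, simple_mul_simple_cancel_right]
    have hai : cs.IsReduced (a ++ [i]) := by
      rw [IsReduced, hat', ← hlen, hat, ha.eq, List.length_append, List.length_singleton]
    obtain ⟨l, hl⟩ := cs.exists_transformsIn_of_isReduced ht hai hat'.symm
    refine ⟨a, _, ha, ?_, ((hk.append [i]).trans (hl.append [i])).trans (.nilMove ?_ (.refl a))⟩
    · rw [← hat, wordProd_append, wordProd_singleton, hts]
    · simpa using NilMove.mk a [] i

/-- Tits' solution of the word problem. -/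
theorem exists_transformsIn_nil {s : List B} (hs : cs.wordProd s = 1) :
    ∃ k, M.TransformsIn k s [] := by
  obtain ⟨t, k, ht, hts, hk⟩ := cs.exists_isReduced_transformsIn s
  have h := ht.eq
  rw [hts, hs, length_one] at h
  obtain rfl := List.length_eq_zero_iff.mp h.symm
  exact ⟨k, hk⟩

end CoxeterSystem

/-! ### Reflection subgroups, the Bruhat graph and Dyer's theorem. -/

namespace CoxeterSystem

variable {B W : Type*} [Group W] {M : CoxeterMatrix B} (cs : CoxeterSystem M W)

theorem IsReflection.lengthParity {t : W} (ht : cs.IsReflection t) :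
    cs.lengthParity t = Multiplicative.ofAdd 1 := by
  obtain ⟨u, i, rfl⟩ := ht
  rw [map_mul, map_mul, map_inv, mul_inv_cancel_comm, lengthParity_simple]

theorem mem_closure_pair_reflections {t₁ t₂ h : W} (ht₁ : cs.IsReflection t₁)
    (ht₂ : cs.IsReflection t₂) (hh : h ∈ Subgroup.closure {t₁, t₂}) :
    ∃ n : ℤ, h = (t₁ * t₂) ^ n ∨ h = (t₁ * t₂) ^ n * t₁ := by
  have hcomm : ∀ n : ℤ, t₁ * (t₁ * t₂) ^ n = (t₁ * t₂) ^ (-n) * t₁ := by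
    intro n
    have h : SemiconjBy t₁ (t₁ * t₂) (t₁ * t₂)⁻¹ := by
      rw [SemiconjBy, mul_inv_rev, ht₁.inv, ht₂.inv, ← mul_assoc, ht₁.mul_self, mul_assoc,
        ht₁.mul_self, one_mul, mul_one]
    have := h.zpow_right n
    rwa [inv_zpow', SemiconjBy] at this
  induction hh using Subgroup.closure_induction with
  | mem x hx =>
    rcases hx with rfl | rfl
    · exact ⟨0, .inr (by simp)⟩
    · refine ⟨-1, .inr ?_⟩
      rw [zpow_neg_one, mul_inv_rev, ht₁.inv, ht₂.inv, mul_assoc, ht₁.mul_self, mul_one]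
  | one => exact ⟨0, .inl (by simp)⟩
  | mul x y _ _ hx hy =>
    obtain ⟨a, rfl | rfl⟩ := hx <;> obtain ⟨b, rfl | rfl⟩ := hy
    · exact ⟨a + b, .inl (by rw [zpow_add])⟩
    · exact ⟨a + b, .inr (by rw [zpow_add, mul_assoc])⟩
    · exact ⟨a + -b, .inr (by rw [mul_assoc, hcomm, zpow_add, mul_assoc])⟩
    · refine ⟨a + -b, .inl ?_⟩
      rw [← mul_assoc, mul_assoc _ t₁, hcomm, zpow_add, ← mul_assoc, mul_assoc, ht₁.mul_self,
        mul_one]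
  | inv x _ hx =>
    obtain ⟨a, rfl | rfl⟩ := hx
    · exact ⟨-a, .inl (by rw [zpow_neg])⟩
    · refine ⟨a, .inr ?_⟩
      rw [mul_inv_rev, ht₁.inv, ← zpow_neg, hcomm, neg_neg]

/-- Parity excludes the rotations `(t₁ t₂)^n`; the other elements `(t₁ t₂)^n t₁` are conjugate to
`t₁` for even `n` and to `t₂` for odd `n`. -/
theorem isReflection_of_mem_closure_pair {t₁ t₂ h : W} (ht₁ : cs.IsReflection t₁)
    (ht₂ : cs.IsReflection t₂) (hh : h ∈ Subgroup.closure {t₁, t₂})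
    (hodd : cs.lengthParity h = Multiplicative.ofAdd 1) : cs.IsReflection h := by
  have hcomm : ∀ n : ℤ, (t₁ * t₂) ^ n * t₁ = t₁ * ((t₁ * t₂) ^ n)⁻¹ := by
    intro n
    have h : SemiconjBy t₁ (t₁ * t₂)⁻¹ (t₁ * t₂) := by
      rw [SemiconjBy, mul_inv_rev, ht₁.inv, ht₂.inv, mul_assoc]
    have := h.zpow_right n
    rw [inv_zpow] at this
    exact this.symm
  obtain ⟨n, rfl | rfl⟩ := cs.mem_closure_pair_reflections ht₁ ht₂ hh
  · rw [map_zpow, map_mul, ht₁.lengthParity, ht₂.lengthParity] at hodd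
    have : (Multiplicative.ofAdd (1 : ZMod 2) * Multiplicative.ofAdd 1) = 1 := by decide
    rw [this, one_zpow] at hodd
    exact absurd hodd (by decide)
  · rcases Int.even_or_odd' n with ⟨m, rfl | rfl⟩
    · rw [two_mul, zpow_add, mul_assoc, hcomm, ← mul_assoc]
      exact ht₁.conj _
    · have : (t₁ * t₂) ^ (2 * m + 1) * t₁ =
          (t₁ * t₂) ^ m * (t₁ * t₂ * t₁⁻¹) * ((t₁ * t₂) ^ m)⁻¹ := by
        rw [ht₁.inv, show 2 * m + 1 = m + (1 + m) by ring, zpow_add, zpow_add, zpow_one,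
          mul_assoc, mul_assoc, hcomm]
        simp only [mul_assoc]
      rw [this]
      exact (ht₂.conj _).conj _

/-- An element with an inversion in a subgroup `H` has an inversion `p` in `H` which is a canonical
generator of `H`: the only inversion of `p` in `H` is `p` itself. -/
theorem exists_canonical_inversion (H : Subgroup W) {w t : W} (htH : t ∈ H)
    (ht : cs.IsRightInversion w t) :
    ∃ p ∈ H, cs.IsRightInversion w p ∧ ∀ r ∈ H, cs.IsRightInversion p r → r = p := by
  obtain ⟨ω, hω, rfl⟩ := cs.exists_isReduced w
  induction ω generalizing t with
  | nil => simp [IsRightInversion] at ht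
  | cons i ω ih =>
    have hω' : cs.IsReduced ω := by simpa using hω.drop 1
    by_cases hex : ∃ r ∈ H, cs.IsRightInversion (cs.wordProd ω) r
    · obtain ⟨r, hrH, hr⟩ := hex
      obtain ⟨p, hpH, hp, hcan⟩ := ih hrH hω' hr
      exact ⟨p, hpH, cs.isRightInversion_of_mem_rightInvSeq hω
        (by rw [rightInvSeq]; exact List.mem_cons_of_mem _ hp.mem_rightInvSeq), hcan⟩
    · push Not at hex
      set v := cs.wordProd ω with hv
      have ht₀ : t = v⁻¹ * cs.simple i * v := by
        have hmem := ht.mem_rightInvSeq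
        rw [rightInvSeq, List.mem_cons] at hmem
        exact hmem.resolve_right fun h =>
          hex t htH (cs.isRightInversion_of_mem_rightInvSeq hω' h)
      refine ⟨t, htH, ht, fun r hrH hr => ?_⟩
      by_contra hne
      -- Compare parities at `r` on both sides: `v` has no inversion in `H`, so the left gives one
      -- and the right zero unless `r = t`.
      have hvt : v * t = cs.simple i * v := by
        rw [ht₀]
        group
      have h₁ := cs.inversionParity_mul v t r
      have h₂ := cs.inversionParity_mul (cs.simple i) v r
      rw [cs.inversionParity_eq_zero_iff.mpr
        (hex _ (H.mul_mem (H.mul_mem htH hrH) (H.inv_mem htH))),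
        cs.inversionParity_eq_one_iff.mpr hr, hvt, h₂,
        cs.inversionParity_eq_zero_iff.mpr (hex r hrH), cs.inversionParity_simple_of_ne] at h₁
      · simp at h₁
      · intro h
        apply hne
        rw [ht₀, h]
        group

/-- A peak `x t₁ < x > x t₂` of the Bruhat graph can be replaced by a lower vertex. -/
theorem exists_lower_of_isRightInversion {x t₁ t₂ : W} (ht₁ : cs.IsRightInversion x t₁)
    (ht₂ : cs.IsRightInversion x t₂) (hne : t₁ ≠ t₂) :
    ∃ r₁ r₂, cs.IsReflection r₁ ∧ cs.IsReflection r₂ ∧ x * t₁ * r₁ = x * t₂ * r₂ ∧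
      cs.length (x * t₁ * r₁) < cs.length x := by
  set H : Subgroup W := Subgroup.closure {t₁, t₂} with hH
  have h₁ : t₁ ∈ H := Subgroup.subset_closure (by simp)
  have h₂ : t₂ ∈ H := Subgroup.subset_closure (by simp)
  obtain ⟨p, hpH, hp, hcan⟩ := cs.exists_canonical_inversion H h₁ ht₁
  obtain ⟨t, htH, ht, htp⟩ : ∃ t ∈ H, cs.IsRightInversion x t ∧ t ≠ p := by
    by_cases h : t₁ = p
    · exact ⟨t₂, h₂, ht₂, fun h' => hne (h.trans h'.symm)⟩
    · exact ⟨t₁, h₁, ht₁, h⟩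
  have hpt : cs.IsRightInversion (x * p) (p * t * p) := by
    have hmem : p * t * p ∈ H := H.mul_mem (H.mul_mem hpH htH) hpH
    have hzero : cs.inversionParity p (p * t * p) = 0 := by
      rw [inversionParity_eq_zero_iff]
      intro h
      have := hcan _ hmem h
      rw [mul_eq_right] at this
      exact htp ((eq_inv_of_mul_eq_one_right this).trans hp.1.inv)
    have hconj : p * (p * t * p) * p = t := by
      rw [mul_assoc p t, ← mul_assoc p p, hp.1.mul_self, one_mul, mul_assoc, hp.1.mul_self, mul_one]
    rw [← inversionParity_eq_one_iff, inversionParity_mul, hzero, add_zero, hp.1.inv, hconj,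
      inversionParity_eq_one_iff]
    exact ht
  -- The lower vertex is `x p q`. It is joined to each `x tₖ` by `tₖ p q`, an odd element of the
  -- dihedral group `H` and hence a reflection.
  obtain ⟨q, hqH, hq, -⟩ := cs.exists_canonical_inversion H
    (H.mul_mem (H.mul_mem hpH htH) hpH) hpt
  have hrefl : ∀ r ∈ H, cs.IsReflection r → cs.IsReflection (r * p * q) := by
    intro r hrH hr
    refine cs.isReflection_of_mem_closure_pair ht₁.1 ht₂.1
      (H.mul_mem (H.mul_mem hrH hpH) hqH) ?_
    rw [map_mul, map_mul, hr.lengthParity, hp.1.lengthParity, hq.1.lengthParity]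
    decide
  have hmul : ∀ r, cs.IsReflection r → x * r * (r * p * q) = x * p * q := by
    intro r hr
    rw [mul_assoc x r, mul_assoc r p, ← mul_assoc r r, hr.mul_self, one_mul, mul_assoc]
  refine ⟨t₁ * p * q, t₂ * p * q, hrefl _ h₁ ht₁.1, hrefl _ h₂ ht₂.1, ?_, ?_⟩
  · rw [hmul _ ht₁.1, hmul _ ht₂.1]
  · rw [hmul _ ht₁.1]
    exact hq.2.trans hp.2

theorem reflectionLength_prod_le {l : List W} (hl : ∀ t ∈ l, cs.IsReflection t) :
    cs.reflectionLength l.prod ≤ l.length :=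
  Nat.sInf_le ⟨l, hl, rfl, rfl⟩

theorem reflectionLength_mul_le (u v : W) :
    cs.reflectionLength (u * v) ≤ cs.reflectionLength u + cs.reflectionLength v := by
  obtain ⟨l, hl, rfl, hlen⟩ := cs.exists_reflection_factorisation u
  obtain ⟨l', hl', rfl, hlen'⟩ := cs.exists_reflection_factorisation v
  rw [← hlen, ← hlen', ← List.prod_append, ← List.length_append]
  refine cs.reflectionLength_prod_le fun t ht => ?_
  rcases List.mem_append.mp ht with h | h
  exacts [hl t h, hl' t h]

@[simp]
theorem reflectionLength_one : cs.reflectionLength (1 : W) = 0 :=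
  Nat.le_zero.mp (cs.reflectionLength_prod_le (l := []) (by simp))

theorem IsReflection.reflectionLength_le_one {t : W} (ht : cs.IsReflection t) :
    cs.reflectionLength t ≤ 1 := by
  simpa using cs.reflectionLength_prod_le (l := [t]) (by simpa using ht)

theorem exists_reflectionLength_mul_lt {w : W} (hw : w ≠ 1) :
    ∃ t, cs.IsReflection t ∧ cs.reflectionLength (w * t) < cs.reflectionLength w := by
  obtain ⟨l, hl, rfl, hlen⟩ := cs.exists_reflection_factorisation w
  obtain ⟨l, t, rfl⟩ := l.eq_nil_or_concat'.resolve_left (by rintro rfl; simp at hw)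
  have ht : cs.IsReflection t := hl t (by simp)
  refine ⟨t, ht, ?_⟩
  have := cs.reflectionLength_prod_le (l := l) fun r hr => hl r (by simp [hr])
  rw [← hlen, List.prod_append, List.prod_singleton, mul_assoc, ht.mul_self, mul_one]
  simp
  omega

/-- A shortest reflection factorisation may be taken to descend in length. -/
theorem exists_isRightInversion_reflectionLength_lt {w : W} (hw : w ≠ 1) :
    ∃ t, cs.IsRightInversion w t ∧ cs.reflectionLength (w * t) < cs.reflectionLength w := by
  induction hn : cs.reflectionLength w using Nat.strong_induction_on generalizing w with
  | _ n ih =>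
    subst hn
    -- Take `w t` of least length. If it lies above `w`, induction supplies a descent from `w t`;
    -- replacing this peak gives a shorter `w r₁` whose reflection length is still below that of
    -- `w`.
    obtain ⟨t, ⟨ht, htw⟩, hmin⟩ := exists_minimalFor_of_wellFoundedLT
      (fun t => cs.IsReflection t ∧ cs.reflectionLength (w * t) < cs.reflectionLength w)
      (fun t => cs.length (w * t)) (cs.exists_reflectionLength_mul_lt hw)
    by_contra hno
    have hlt : cs.length w < cs.length (w * t) := by
      refine lt_of_le_of_ne (not_lt.mp fun h => hno ⟨t, ⟨ht, h⟩, htw⟩) ?_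
      exact (ht.length_mul_left_ne w).symm
    have hx : w * t ≠ 1 := by
      intro h
      simp [h] at hlt
    obtain ⟨t', ht', htx⟩ := ih _ htw hx rfl
    have hwt : w * t * t = w := by rw [mul_assoc, ht.mul_self, mul_one]
    have htinv : cs.IsRightInversion (w * t) t := ⟨ht, by rwa [hwt]⟩
    have hne : t ≠ t' := by
      rintro rfl
      rw [hwt] at htx
      omega
    obtain ⟨r₁, r₂, hr₁, hr₂, heq, hlow⟩ := cs.exists_lower_of_isRightInversion htinv ht' hne
    rw [hwt] at heq hlow
    have h₁ := cs.reflectionLength_mul_le (w * t * t') r₂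
    have h₂ := hr₂.reflectionLength_le_one
    have := hmin (j := r₁) ⟨hr₁, by rw [heq]; omega⟩ hlow.le
    exact absurd hlow (not_lt.mpr this)

/-- Dyer's theorem: some subword obtained by omitting `l_R(w)` letters represents `1`. -/
theorem exists_sublist_wordProd_eq_one (ω : List B) :
    ∃ ω' : List B, ω'.Sublist ω ∧ cs.wordProd ω' = 1 ∧
      ω.length ≤ ω'.length + cs.reflectionLength (cs.wordProd ω) := by
  induction hn : cs.reflectionLength (cs.wordProd ω) using Nat.strong_induction_on
    generalizing ω with
  | _ n ih =>
    subst hn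
    by_cases hw : cs.wordProd ω = 1
    · exact ⟨ω, List.Sublist.refl ω, hw, Nat.le_add_right _ _⟩
    obtain ⟨t, ht, hlt⟩ := cs.exists_isRightInversion_reflectionLength_lt hw
    obtain ⟨p, hp, he⟩ := ht.exists_eraseIdx
    rw [he] at hlt
    obtain ⟨ω', hsub, hone, hle⟩ := ih _ hlt _ rfl
    refine ⟨ω', hsub.trans (List.eraseIdx_sublist ω p), hone, ?_⟩
    have := List.length_eraseIdx_add_one hp
    omega

end CoxeterSystem

/-! ### Reflection length under moves and deletions. -/

namespace CoxeterSystem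

variable {B W : Type*} [Group W] {M : CoxeterMatrix B} (cs : CoxeterSystem M W)

/-- The words differ by one letter at each end: `y = s_h x s_j`, so `x y⁻¹ = (x s_j x⁻¹) s_h`. The
length `m` is arbitrary, so braid-moves of `W` can be measured in `W_n`. -/
theorem reflectionLength_alternatingWord_mul_inv_le (i j : B) (m : ℕ) :
    cs.reflectionLength
      (cs.wordProd (alternatingWord i j m) * (cs.wordProd (alternatingWord j i m))⁻¹) ≤ 2 := by
  obtain ⟨h, hh⟩ : ∃ h, cs.wordProd (alternatingWord j i m) * cs.simple j =
      cs.simple h * cs.wordProd (alternatingWord i j m) := by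
    refine ⟨if Even m then j else i, ?_⟩
    rw [← wordProd_concat, ← alternatingWord_succ, alternatingWord_succ', wordProd_cons]
  set x := cs.wordProd (alternatingWord i j m)
  have hy : cs.wordProd (alternatingWord j i m) = cs.simple h * x * cs.simple j := by
    rw [← hh, simple_mul_simple_cancel_right]
  have he : x * (cs.wordProd (alternatingWord j i m))⁻¹ =
      x * cs.simple j * x⁻¹ * cs.simple h := by
    rw [hy]
    simp [mul_assoc]
  rw [he]
  refine (cs.reflectionLength_mul_le _ _).trans ?_
  have h₁ := ((cs.isReflection_simple j).conj x).reflectionLength_le_one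
  have h₂ := (cs.isReflection_simple h).reflectionLength_le_one
  omega

theorem reflectionLength_conj_le (u v : W) :
    cs.reflectionLength (u * v * u⁻¹) ≤ cs.reflectionLength v := by
  obtain ⟨l, hl, rfl, hlen⟩ := cs.exists_reflection_factorisation v
  have h := cs.reflectionLength_prod_le (l := l.map (MulAut.conj u)) fun t ht => by
    obtain ⟨r, hr, rfl⟩ := List.mem_map.mp ht
    exact (hl r hr).conj u
  rw [← hlen]
  rwa [← map_list_prod, MulAut.conj_apply, List.length_map] at h

/-- For any two Coxeter systems on the same generators, a sequence of moves for one of them changes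
the reflection length in the other by at most twice the number of braid-moves. -/
theorem reflectionLength_le_of_transformsIn {M' : CoxeterMatrix B} {k : ℕ} {s t : List B}
    (h : M'.TransformsIn k s t) :
    cs.reflectionLength (cs.wordProd s) ≤ cs.reflectionLength (cs.wordProd t) + 2 * k := by
  induction h with
  | refl => exact Nat.le_add_right _ _
  | nilMove hm _ ih =>
    obtain ⟨a, b, i⟩ := hm
    simpa [wordProd_append, wordProd_cons] using ih
  | braidMove hm _ ih =>
    obtain ⟨a, b, i, j, hij, hfin⟩ := hm
    refine (?_ : _ ≤ 2 + _).trans (Nat.add_le_add_left ih 2) |>.trans (by omega)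
    set x := cs.wordProd (braidWord M' i j) with hx
    set y := cs.wordProd (braidWord M' j i) with hy
    have he : cs.wordProd (a ++ braidWord M' i j ++ b) =
        cs.wordProd a * (x * y⁻¹) * (cs.wordProd a)⁻¹ *
          cs.wordProd (a ++ braidWord M' j i ++ b) := by
      simp only [wordProd_append, ← hx, ← hy]
      group
    rw [he]
    refine (cs.reflectionLength_mul_le _ _).trans (Nat.add_le_add_right ?_ _)
    refine (cs.reflectionLength_conj_le _ _).trans ?_
    rw [hx, hy, braidWord, braidWord, M'.symmetric j i]
    exact cs.reflectionLength_alternatingWord_mul_inv_le i j _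

/-- Omitting letters of a word changes the represented element by a product of as many
reflections. -/
theorem reflectionLength_map_mul_inv_filter_le {α : Type*} (g : α → B) (p : α → Bool)
    (l : List α) :
    cs.reflectionLength (cs.wordProd (l.map g) * (cs.wordProd ((l.filter p).map g))⁻¹) ≤
      (l.filter fun a => !p a).length := by
  induction l with
  | nil => simp
  | cons a l ih =>
    cases hp : p a
    · rw [List.filter_cons_of_neg (by simp [hp]), List.filter_cons_of_pos (by simp [hp]),
        List.map_cons, wordProd_cons, mul_assoc, List.length_cons]
      have h₁ := cs.reflectionLength_mul_le (cs.simple (g a))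
        (cs.wordProd (l.map g) * (cs.wordProd ((l.filter p).map g))⁻¹)
      have h₂ := (cs.isReflection_simple (g a)).reflectionLength_le_one
      omega
    · rw [List.filter_cons_of_pos (by simp [hp]), List.filter_cons_of_neg (by simp [hp]),
        List.map_cons, List.map_cons, wordProd_cons, wordProd_cons, mul_inv_rev, ← mul_assoc,
        mul_assoc (cs.simple (g a)), inv_simple]
      have := cs.reflectionLength_conj_le (cs.simple (g a))
        (cs.wordProd (l.map g) * (cs.wordProd ((l.filter p).map g))⁻¹)
      rw [inv_simple] at this
      exact this.trans ih

theorem reflectionLength_wordProd_le_card_add (s : List B) (D : Finset (Fin s.length)) :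
    cs.reflectionLength (cs.wordProd s) ≤
      D.card + cs.reflectionLength (cs.wordProd (omitLetters s D)) := by
  have h := cs.reflectionLength_map_mul_inv_filter_le s.get (fun p => decide (p ∉ D))
    (List.finRange s.length)
  have hs : (List.finRange s.length).map s.get = s := by simp
  have hD : ((List.finRange s.length).filter fun p => !decide (p ∉ D)).length = D.card := by
    rw [← List.toFinset_card_of_nodup ((List.nodup_finRange _).filter _)]
    congr 1
    ext p
    simp
  rw [hs, hD] at h
  have h' := cs.reflectionLength_mul_le
    (cs.wordProd s * (cs.wordProd (omitLetters s D))⁻¹) (cs.wordProd (omitLetters s D))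
  rw [inv_mul_cancel_right] at h'
  exact h'.trans (Nat.add_le_add_right h _)

theorem exists_omitLetters_eq_of_sublist {s t : List B} (h : t.Sublist s) :
    ∃ E : Finset (Fin s.length), omitLetters s E = t ∧ E.card + t.length = s.length := by
  have hs : (List.finRange s.length).map s.get = s := by simp
  rw [← hs, List.sublist_map_iff] at h
  obtain ⟨l, hl, rfl⟩ := h
  have hnd : l.Nodup := hl.nodup (List.nodup_finRange _)
  have hfilter : (List.finRange s.length).filter (fun p => p ∉ (l.toFinset)ᶜ) = l := by
    simp only [Finset.mem_compl, List.mem_toFinset, not_not]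
    have hsub := hl.filter (fun p => decide (p ∈ l))
    rw [List.filter_eq_self.mpr (by simp)] at hsub
    refine (hsub.eq_of_length_le (List.Subperm.length_le ?_)).symm
    exact ((List.nodup_finRange _).filter _).subperm fun p hp => by simpa using hp
  refine ⟨(l.toFinset)ᶜ, ?_, ?_⟩
  · rw [omitLetters, hfilter]
  · have := Finset.card_compl_add_card l.toFinset
    rw [List.toFinset_card_of_nodup hnd, Fintype.card_fin] at this
    rwa [List.length_map]

/-- A deletion set of a word has at most as many elements as the reflection length of the element
represented by that word. -/
theorem IsDeletionSet.card_le_reflectionLength {s : List B} {D : Finset (Fin s.length)}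
    (hD : cs.IsDeletionSet s D) : D.card ≤ cs.reflectionLength (cs.wordProd s) := by
  obtain ⟨t, hsub, ht, hle⟩ := cs.exists_sublist_wordProd_eq_one s
  obtain ⟨E, rfl, hE⟩ := exists_omitLetters_eq_of_sublist hsub
  have := hD.2 E ht
  omega

end CoxeterSystem

theorem mainTheorem2 {B : Type*} [Finite B] {W : Type*} [Group W] {M : CoxeterMatrix B}
    (cs : CoxeterSystem M W) (w : W) (s : List B) (hs : cs.IsReduced s) (hw : cs.wordProd s = w)
    (D : Finset (Fin s.length)) (hD : cs.IsDeletionSet s D) :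
    ∃ m : ℕ,
      IsLeast {k : ℕ | M.TransformsIn k (CoxeterSystem.omitLetters s D) []} m ∧
      ((CoxeterMatrix.universal B).toCoxeterSystem.reflectionLength
          ((CoxeterMatrix.universal B).toCoxeterSystem.wordProd s) : ℤ) - 2 * (m : ℤ)
        ≤ (cs.reflectionLength w : ℤ) := by
  classical
  subst hw
  have hex := cs.exists_transformsIn_nil hD.1
  refine ⟨Nat.find hex, ⟨Nat.find_spec hex, fun k hk => Nat.find_min' hex hk⟩, ?_⟩
  -- The moves are those of `M`, but the reflection length is measured in the universal group.
  have h₁ := (CoxeterMatrix.universal B).toCoxeterSystem.reflectionLength_le_of_transformsIn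
    (Nat.find_spec hex)
  have h₂ :=
    (CoxeterMatrix.universal B).toCoxeterSystem.reflectionLength_wordProd_le_card_add s D
  have h₃ := hD.card_le_reflectionLength
  rw [CoxeterSystem.wordProd_nil, CoxeterSystem.reflectionLength_one] at h₁
  omega
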